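/- Let $k$ be a commutative artinian ring, let $\check k$ be the minimal injective cogenerator of the category of finitely generated $k$-modules, and put $D=\operatorname{Hom}_k(-,\check k)$. Let $n\ge 1$ and let $(\mathcal C,\mathbb E,\mathfrak s)$ be a $k$-linear $n$-exangulated category in the sense of Herschend–Liu–Nakaoka (so $\mathbb E:\mathcal C^{\mathrm{op}}\times\mathcal C\to k\text{-Mod}$ is $k$-bilinear) which is Krull–Schmidt (every object is a finite direct sum of objects with local endomorphism rings) and Ext-finite (every $\mathbb E(C,A)$ is a finitely generated $k$-module). For objects $A,B$ let $\mathcal P(A,B)$ be the set of $f\in\mathcal C(A,B)$ with $\mathbb E(f,Z)=0$ for all $Z\in\mathcal C$, and let $\mathcal I(A,B)$ be the set of $g\in\mathcal C(A,B)$ with $\mathbb E(Z,g)=0$ for all $Z\in\mathcal C$. Let $\overline{\mathcal C}$ be the category with the objects of $\mathcal C$ and $\overline{\mathcal C}(A,B)=\mathcal C(A,B)/\mathcal I(A,B)$. Let $\mathcal C_r$ be the class of objects $X$ such that the contravariant functor $D\mathbb E(X,-)$ from $\overline{\mathcal C}$ to finitely generated $k$-modules is representable; for $X\in\mathcal C_r$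 let $\tau_nX$ be any object with an isomorphism of functors $\overline{\mathcal C}(-,\tau_nX)\cong D\mathbb E(X,-)$. For an object $T$, $\operatorname{add}(T)$ is the class of direct summands of finite direct sums of copies of $T$. A morphism $f:X\to Y$ is right $C$-determined if every $g:L\to Y$, such that $g\circ h$ factors through $f$ for all $h:C\to L$, itself factors through $f$. Let $C\in\mathcal C_r$, let $X_{n+1}\in\mathcal C$, and let $H$ be a right $\operatorname{End}_{\mathcal C}(C)$-submodule of $\mathcal C(C,X_{n+1})$ with $\mathcal P(C,X_{n+1})\subseteq H$. Then there exists a distinguished $n$-exangle $$X_0\to X_1\to\cdots\to X_n\xrightarrow{\ \alpha\ }X_{n+1}\overset{\eta}{\dashrightarrow}$$ such that $\alpha$ is right $C$-determined, $X_0\in\operatorname{add}(\tau_nC)$, and $H=\operatorname{Im}\mathcal C(C,\alpha)$. -/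

import Mathlib

open CategoryTheory CategoryTheory.Limits

attribute [local instance] hasBinaryBiproducts_of_finite_biproducts

universe w r v u

namespace NExang

/-! ### Minimal injective cogenerators of the category of finitely generated modules -/

/-- `K` cogenerates the finitely generated `k`-modules: every nonzero element of a finitely
generated module is detected by a linear map to `K`. -/
def IsCogenerator (k : Type r) [CommRing k] (K : Type r) [AddCommGroup K] [Module k K] : Prop :=
  ∀ (M : Type r) [AddCommGroup M] [Module k M], Module.Finite k M →
    ∀ x : M, x ≠ 0 → ∃ f : M →ₗ[k] K, f x ≠ 0

/-- `K` is a minimal injective cogenerator of the category `k`-mod of finitely generated modules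
(`k` artinian): an object of `k`-mod that is an injective cogenerator, no proper submodule of which
is an injective cogenerator.  (By Baer's criterion, injectivity in `k`-mod and in the category of all
`k`-modules agree.) -/
structure IsMinimalInjectiveCogenerator (k : Type r) [CommRing k]
    (K : Type r) [AddCommGroup K] [Module k K] : Prop where
  finite : Module.Finite k K
  injective : Module.Injective k K
  cogenerator : IsCogenerator k K
  minimal : ∀ N : Submodule k K, Module.Injective k N → IsCogenerator k N → N = ⊤

/-! ### Complexes with `n + 2` terms -/

section Complexes

variable {𝒞 : Type u} [Category.{v} 𝒞] [Preadditive 𝒞]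

/-- A complex `X_0 ⟶ X_1 ⟶ ⋯ ⟶ X_{n+1}` (zero outside the degrees `0, …, n + 1`) whose end terms
`X_0` and `X_{n+1}` are identified with the given objects `A` and `C`. -/
structure NComplex (n : ℕ) (A C : 𝒞) where
  cx : CochainComplex 𝒞 ℕ
  isZero : ∀ i, n + 1 < i → IsZero (cx.X i)
  left : cx.X 0 ≅ A
  right : cx.X (n + 1) ≅ C

namespace NComplex

variable {n : ℕ} {A C : 𝒞}

/-- The first differential `A ⟶ X_1`. -/
def dFirst (X : NComplex n A C) : A ⟶ X.cx.X 1 := X.left.inv ≫ X.cx.d 0 1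

/-- The last differential `X_n ⟶ C`. -/
def dLast (X : NComplex n A C) : X.cx.X n ⟶ C := X.cx.d n (n + 1) ≫ X.right.hom

/-- The morphism of complexes `f` has the form `(a, f_1, …, f_n, c)`. -/
structure HasEnds {A' C' : 𝒞} (X : NComplex n A C) (Y : NComplex n A' C')
    (a : A ⟶ A') (c : C ⟶ C') (f : X.cx ⟶ Y.cx) : Prop where
  left : f.f 0 ≫ Y.left.hom = X.left.hom ≫ a
  right : f.f (n + 1) ≫ Y.right.hom = X.right.hom ≫ c

/-- Homotopy equivalence of complexes with fixed end terms `A`, `C`: the two mutually inverse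
(up to homotopy) morphisms are the identity on both end terms. -/
def HtpyEquiv (X Y : NComplex n A C) : Prop :=
  ∃ (f : X.cx ⟶ Y.cx) (g : Y.cx ⟶ X.cx),
    HasEnds X Y (𝟙 A) (𝟙 C) f ∧ HasEnds Y X (𝟙 A) (𝟙 C) g ∧
    Nonempty (Homotopy (f ≫ g) (𝟙 X.cx)) ∧ Nonempty (Homotopy (g ≫ f) (𝟙 Y.cx))

lemma HasEnds.comp_id {X Y Z : NComplex n A C} {f : X.cx ⟶ Y.cx} {g : Y.cx ⟶ Z.cx}
    (hf : HasEnds X Y (𝟙 A) (𝟙 C) f) (hg : HasEnds Y Z (𝟙 A) (𝟙 C) g) :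
    HasEnds X Z (𝟙 A) (𝟙 C) (f ≫ g) where
  left := by
    have h1 := hf.left
    have h2 := hg.left
    simp only [Category.comp_id] at h1 h2
    simp [h1, h2]
  right := by
    have h1 := hf.right
    have h2 := hg.right
    simp only [Category.comp_id] at h1 h2
    simp [h1, h2]

lemma HtpyEquiv.refl (X : NComplex n A C) : HtpyEquiv X X :=
  ⟨𝟙 _, 𝟙 _, ⟨by simp, by simp⟩, ⟨by simp, by simp⟩,
    ⟨Homotopy.ofEq (by simp)⟩, ⟨Homotopy.ofEq (by simp)⟩⟩

lemma HtpyEquiv.symm {X Y : NComplex n A C} (h : HtpyEquiv X Y) : HtpyEquiv Y X := by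
  obtain ⟨f, g, hf, hg, h1, h2⟩ := h
  exact ⟨g, f, hg, hf, h2, h1⟩

lemma HtpyEquiv.trans {X Y Z : NComplex n A C} (h : HtpyEquiv X Y) (h' : HtpyEquiv Y Z) :
    HtpyEquiv X Z := by
  obtain ⟨f, g, hf, hg, ⟨h1⟩, ⟨h2⟩⟩ := h
  obtain ⟨f', g', hf', hg', ⟨h1'⟩, ⟨h2'⟩⟩ := h'
  let e : HomotopyEquiv X.cx Y.cx := ⟨f, g, h1, h2⟩
  let e' : HomotopyEquiv Y.cx Z.cx := ⟨f', g', h1', h2'⟩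
  exact ⟨f ≫ f', g' ≫ g, hf.comp_id hf', hg'.comp_id hg,
    ⟨(e.trans e').homotopyHomInvId⟩, ⟨(e.trans e').homotopyInvHomId⟩⟩

/-- The setoid of homotopy equivalence with fixed end terms. -/
def htpySetoid (n : ℕ) (A C : 𝒞) : Setoid (NComplex n A C) where
  r := HtpyEquiv
  iseqv := ⟨HtpyEquiv.refl, HtpyEquiv.symm, HtpyEquiv.trans⟩

end NComplex

/-- Homotopy equivalence classes `[X]` of complexes with `n + 2` terms and end terms `A`, `C`. -/
def HtpyClass (n : ℕ) (A C : 𝒞) : Type _ := Quotient (NComplex.htpySetoid n A C)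

/-- The class `[X]` of a complex. -/
def NComplex.cls {n : ℕ} {A C : 𝒞} (X : NComplex n A C) : HtpyClass n A C :=
  Quotient.mk (NComplex.htpySetoid n A C) X

variable [HasFiniteBiproducts 𝒞]

/-- `M` is the mapping cone of a morphism `f : X ⟶ Y` with `f_0 = id_A`:
`X_1 ⟶ X_2 ⊞ Y_1 ⟶ ⋯ ⟶ X_{n+1} ⊞ Y_n ⟶ Y_{n+1}`, with first differential `(-d, f_1)`, middle
differentials `(x, y) ↦ (-d x, f x + d y)` and last differential `(x, y) ↦ f x + d y`.
The middle terms of `M` are identified with the biproducts by the isomorphisms `φ`. -/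
def IsMappingCone {n : ℕ} {A C D : 𝒞} (X : NComplex n A C) (Y : NComplex n A D)
    (f : X.cx ⟶ Y.cx) (M : NComplex n (X.cx.X 1) D) : Prop :=
  ∃ φ : ∀ i, 1 ≤ i → i ≤ n → (M.cx.X i ≅ X.cx.X (i + 1) ⊞ Y.cx.X i),
    (∀ h : 1 ≤ n, M.dFirst ≫ (φ 1 le_rfl h).hom = biprod.lift (-X.cx.d 1 2) (f.f 1)) ∧
    (∀ i (h : 1 ≤ i) (h' : i + 1 ≤ n),
      M.cx.d i (i + 1) ≫ (φ (i + 1) (by omega) h').hom =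
        (φ i h (by omega)).hom ≫
          biprod.desc (biprod.lift (-X.cx.d (i + 1) (i + 2)) (f.f (i + 1)))
            (biprod.lift 0 (Y.cx.d i (i + 1)))) ∧
    (∀ h : 1 ≤ n, M.dLast =
      (φ n h le_rfl).hom ≫ biprod.desc (f.f (n + 1) ≫ Y.right.hom) Y.dLast)

/-- `M` is the mapping cocone of a morphism `h : X ⟶ Y` with `h_{n+1} = id_C` (the construction
dual to the mapping cone):
`X_0 ⟶ X_1 ⊞ Y_0 ⟶ ⋯ ⟶ X_n ⊞ Y_{n-1} ⟶ Y_n`, with first differential `(d, h_0)`, middle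
differentials `(x, y) ↦ (d x, h x - d y)` and last differential `(x, y) ↦ h x - d y`.
The middle terms `M_j` are identified with `X_j ⊞ Y_i`, `i + 1 = j`, by the isomorphisms `φ`. -/
def IsMappingCocone {n : ℕ} {A B C : 𝒞} (X : NComplex n A C) (Y : NComplex n B C)
    (h : X.cx ⟶ Y.cx) (M : NComplex n A (Y.cx.X n)) : Prop :=
  ∃ φ : ∀ i j, i + 1 = j → j ≤ n → (M.cx.X j ≅ X.cx.X j ⊞ Y.cx.X i),
    (∀ hn : 1 ≤ n, M.dFirst ≫ (φ 0 1 rfl hn).hom =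
      biprod.lift X.dFirst (X.left.inv ≫ h.f 0)) ∧
    (∀ i j l (hij : i + 1 = j) (hjl : j + 1 = l) (hl : l ≤ n),
      M.cx.d j l ≫ (φ j l hjl hl).hom =
        (φ i j hij (by omega)).hom ≫
          biprod.desc (biprod.lift (X.cx.d j l) (h.f j)) (biprod.lift 0 (-Y.cx.d i j))) ∧
    (∀ i (hi : i + 1 = n), M.dLast =
      (φ i n hi le_rfl).hom ≫ biprod.desc (h.f n) (-Y.cx.d i n))

end Complexes

/-! ### `k`-linear `n`-exangulated categories -/

/-- A `k`-bilinear bifunctor `𝔼 : 𝒞ᵒᵖ × 𝒞 ⥤ k-Mod`. -/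
structure ExtBifunctor (k : Type r) [CommRing k] (𝒞 : Type u) [Category.{v} 𝒞] [Preadditive 𝒞]
    [Linear k 𝒞] where
  functor : 𝒞ᵒᵖ ⥤ 𝒞 ⥤ ModuleCat.{w} k
  additive_left : ∀ A : 𝒞, (functor.flip.obj A).Additive
  linear_left : ∀ (A : 𝒞) {C C' : 𝒞} (c : C' ⟶ C) (t : k),
    (functor.map (t • c).op).app A = t • (functor.map c.op).app A
  additive_right : ∀ C : 𝒞ᵒᵖ, (functor.obj C).Additive
  linear_right : ∀ C : 𝒞ᵒᵖ, (functor.obj C).Linear k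

section Exang

variable {k : Type r} [CommRing k] {𝒞 : Type u} [Category.{v} 𝒞] [Preadditive 𝒞] [Linear k 𝒞]

namespace ExtBifunctor

variable (E : ExtBifunctor.{w} k 𝒞)

/-- The module of extensions `𝔼(C, A)`. -/
abbrev Ext (C A : 𝒞) : ModuleCat.{w} k := (E.functor.obj (Opposite.op C)).obj A

/-- `a_* : 𝔼(C, A) → 𝔼(C, A')` for `a : A ⟶ A'`. -/
def push {C A A' : 𝒞} (a : A ⟶ A') : E.Ext C A →ₗ[k] E.Ext C A' :=
  ((E.functor.obj (Opposite.op C)).map a).hom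

/-- `c^* : 𝔼(C, A) → 𝔼(C', A)` for `c : C' ⟶ C`. -/
def pull {C C' A : 𝒞} (c : C' ⟶ C) : E.Ext C A →ₗ[k] E.Ext C' A :=
  ((E.functor.map c.op).app A).hom

/-- `⟨X, δ⟩` is an `n`-exangle: the two sequences
`𝒞(-, X_0) → ⋯ → 𝒞(-, X_{n+1}) → 𝔼(-, X_0)` and `𝒞(X_{n+1}, -) → ⋯ → 𝒞(X_0, -) → 𝔼(X_{n+1}, -)`
are exact (at all terms that are not end terms), and `(d_0)_* δ = 0`, `(d_n)^* δ = 0`. -/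
structure IsExangle {n : ℕ} {A C : 𝒞} (X : NComplex n A C) (δ : E.Ext C A) : Prop where
  push_eq_zero : E.push X.dFirst δ = 0
  pull_eq_zero : E.pull X.dLast δ = 0
  exact_contra : ∀ (W : 𝒞) (i : ℕ), i < n →
    Function.Exact (fun g : W ⟶ X.cx.X i => g ≫ X.cx.d i (i + 1))
      (fun g : W ⟶ X.cx.X (i + 1) => g ≫ X.cx.d (i + 1) (i + 2))
  exact_contra_last : ∀ W : 𝒞,
    Function.Exact (fun g : W ⟶ X.cx.X n => g ≫ X.dLast) (fun g : W ⟶ C => E.pull g δ)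
  exact_co : ∀ (W : 𝒞) (i : ℕ), i < n →
    Function.Exact (fun g : X.cx.X (i + 2) ⟶ W => X.cx.d (i + 1) (i + 2) ≫ g)
      (fun g : X.cx.X (i + 1) ⟶ W => X.cx.d i (i + 1) ≫ g)
  exact_co_last : ∀ W : 𝒞,
    Function.Exact (fun g : X.cx.X 1 ⟶ W => X.dFirst ≫ g) (fun g : A ⟶ W => E.push g δ)

/-- An exact realization `𝔰` of `𝔼`. -/
structure ExactRealization (n : ℕ) where
  /-- the class `𝔰(δ)` attached to an extension -/
  s : ∀ {A C : 𝒞}, E.Ext C A → HtpyClass n A C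
  /-- (R0) every morphism of extensions lifts -/
  lift : ∀ {A C A' C' : 𝒞} (δ : E.Ext C A) (ρ : E.Ext C' A')
    (X : NComplex n A C) (Y : NComplex n A' C'), s δ = X.cls → s ρ = Y.cls →
    ∀ (a : A ⟶ A') (c : C ⟶ C'), E.push a δ = E.pull c ρ →
      ∃ f : X.cx ⟶ Y.cx, NComplex.HasEnds X Y a c f
  /-- (R1) -/
  exangle : ∀ {A C : 𝒞} (δ : E.Ext C A) (X : NComplex n A C), s δ = X.cls → E.IsExangle X δ
  /-- (R2) `𝔰(0) = [A = A ⟶ 0 ⟶ ⋯ ⟶ 0]` for `0 ∈ 𝔼(0, A)` -/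
  zero_right : ∀ {A Z : 𝒞}, IsZero Z → ∀ X : NComplex n A Z, IsIso (X.cx.d 0 1) →
    (∀ i, 2 ≤ i → IsZero (X.cx.X i)) → s (0 : E.Ext Z A) = X.cls
  /-- (R2), dual part: `𝔰(0) = [0 ⟶ ⋯ ⟶ 0 ⟶ A = A]` for `0 ∈ 𝔼(A, 0)` -/
  zero_left : ∀ {A Z : 𝒞}, IsZero Z → ∀ X : NComplex n Z A, IsIso (X.cx.d n (n + 1)) →
    (∀ i, i < n → IsZero (X.cx.X i)) → s (0 : E.Ext A Z) = X.cls

namespace ExactRealization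

variable {E} {n : ℕ} (S : E.ExactRealization n)

/-- `⟨X, δ⟩` is a distinguished `n`-exangle: `𝔰(δ) = [X]`. -/
def Distinguished {A C : 𝒞} (X : NComplex n A C) (δ : E.Ext C A) : Prop := S.s δ = X.cls

/-- `f : A ⟶ B` is the first differential of a conflation. -/
def IsInflation {A B : 𝒞} (f : A ⟶ B) : Prop :=
  ∃ (C : 𝒞) (X : NComplex n A C) (δ : E.Ext C A) (b : X.cx.X 1 ≅ B),
    S.Distinguished X δ ∧ X.dFirst ≫ b.hom = f

/-- `g : B ⟶ C` is the last differential of a conflation. -/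
def IsDeflation {B C : 𝒞} (g : B ⟶ C) : Prop :=
  ∃ (A : 𝒞) (X : NComplex n A C) (δ : E.Ext C A) (b : B ≅ X.cx.X n),
    S.Distinguished X δ ∧ b.hom ≫ X.dLast = g

end ExactRealization

end ExtBifunctor

variable (k 𝒞)

/-- A `k`-linear `n`-exangulated category structure `(𝔼, 𝔰)` on the additive `k`-linear category
`𝒞`. -/
structure NExangulated [HasFiniteBiproducts 𝒞] (n : ℕ) where
  E : ExtBifunctor.{w} k 𝒞
  S : E.ExactRealization n
  /-- (EA1) -/
  comp_inflation : ∀ {A B C : 𝒞} (f : A ⟶ B) (g : B ⟶ C),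
    S.IsInflation f → S.IsInflation g → S.IsInflation (f ≫ g)
  comp_deflation : ∀ {A B C : 𝒞} (f : A ⟶ B) (g : B ⟶ C),
    S.IsDeflation f → S.IsDeflation g → S.IsDeflation (f ≫ g)
  /-- (EA2) existence of good lifts of `(id_A, c)` -/
  good_lift : ∀ {A C D : 𝒞} (ρ : E.Ext D A) (c : C ⟶ D)
    (X : NComplex n A C) (Y : NComplex n A D),
    S.Distinguished X (E.pull c ρ) → S.Distinguished Y ρ →
    ∃ f : X.cx ⟶ Y.cx, NComplex.HasEnds X Y (𝟙 A) c f ∧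
      ∃ M : NComplex n (X.cx.X 1) D, IsMappingCone X Y f M ∧
        S.Distinguished M (E.push X.dFirst ρ)
  /-- (EA2ᵒᵖ) existence of good lifts of `(a, id_C)` -/
  good_lift_op : ∀ {A B C : 𝒞} (ρ : E.Ext C A) (a : A ⟶ B)
    (X : NComplex n A C) (Y : NComplex n B C),
    S.Distinguished X ρ → S.Distinguished Y (E.push a ρ) →
    ∃ h : X.cx ⟶ Y.cx, NComplex.HasEnds X Y a (𝟙 C) h ∧
      ∃ M : NComplex n A (Y.cx.X n), IsMappingCocone X Y h M ∧
        S.Distinguished M (E.pull Y.dLast ρ)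

end Exang

/-- `𝒞` is Krull-Schmidt: every object is a finite direct sum of objects with local endomorphism
rings. -/
def IsKrullSchmidt (𝒞 : Type u) [Category.{v} 𝒞] [Preadditive 𝒞] [HasFiniteBiproducts 𝒞] : Prop :=
  ∀ X : 𝒞, ∃ (m : ℕ) (Y : Fin m → 𝒞),
    (∀ i, IsLocalRing (End (Y i))) ∧ Nonempty (X ≅ ⨁ Y)

/-- `X` lies in `add T`: it is a direct summand of a finite direct sum of copies of `T`. -/
def InAdd {𝒞 : Type u} [Category.{v} 𝒞] [Preadditive 𝒞] [HasFiniteBiproducts 𝒞] (T X : 𝒞) : Prop :=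
  ∃ (m : ℕ) (Z : 𝒞), Nonempty (X ⊞ Z ≅ ⨁ fun _ : Fin m => T)

/-- `f : X ⟶ Y` is right `C`-determined. -/
def IsRightDetermined {𝒞 : Type u} [Category.{v} 𝒞] (C : 𝒞) {X Y : 𝒞} (f : X ⟶ Y) : Prop :=
  ∀ (L : 𝒞) (g : L ⟶ Y), (∀ h : C ⟶ L, ∃ s : C ⟶ X, s ≫ f = h ≫ g) → ∃ t : L ⟶ X, t ≫ f = g

/-! ### Stable morphisms, `𝒞_r` and `τ_n` -/

namespace ExtBifunctor

variable {k : Type r} [CommRing k] {𝒞 : Type u} [Category.{v} 𝒞] [Preadditive 𝒞] [Linear k 𝒞]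
  (E : ExtBifunctor.{w} k 𝒞)

/-- `𝔼` is Ext-finite. -/
def ExtFinite : Prop := ∀ C A : 𝒞, Module.Finite k (E.Ext C A)

/-- `𝒫(A, B)`: the `n`-projectively trivial morphisms `f : A ⟶ B`, i.e. those with
`𝔼(f, Z) = 0` for all `Z`. -/
def projTrivial (A B : 𝒞) : Submodule k (A ⟶ B) where
  carrier := {f | ∀ (Z : 𝒞) (δ : E.Ext B Z), E.pull f δ = 0}
  zero_mem' := fun Z δ => by
    have := E.additive_left Z
    have h : E.pull (A := Z) (0 : A ⟶ B) = 0 := by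
      change ((E.functor.flip.obj Z).map (0 : A ⟶ B).op).hom = 0
      rw [op_zero, Functor.map_zero]; rfl
    rw [h]; rfl
  add_mem' := fun {f g} hf hg Z δ => by
    have := E.additive_left Z
    have h : E.pull (A := Z) (f + g) = E.pull f + E.pull g := by
      change ((E.functor.flip.obj Z).map (f + g).op).hom = _
      rw [op_add, Functor.map_add]; rfl
    rw [h, LinearMap.add_apply, hf, hg, add_zero]
  smul_mem' := fun c f hf Z δ => by
    have h : E.pull (A := Z) (c • f) = c • E.pull f := by
      simp only [pull, E.linear_left]; rfl
    rw [h, LinearMap.smul_apply, hf, smul_zero]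

/-- `ℐ(A, B)`: the `n`-injectively trivial morphisms `g : A ⟶ B`, i.e. those with
`𝔼(Z, g) = 0` for all `Z`. -/
def injTrivial (A B : 𝒞) : Submodule k (A ⟶ B) where
  carrier := {g | ∀ (Z : 𝒞) (δ : E.Ext Z A), E.push g δ = 0}
  zero_mem' := fun Z δ => by
    have := E.additive_right (Opposite.op Z)
    have h : E.push (C := Z) (0 : A ⟶ B) = 0 := by
      simp only [push, Functor.map_zero]; rfl
    rw [h]; rfl
  add_mem' := fun {f g} hf hg Z δ => by
    have := E.additive_right (Opposite.op Z)
    have h : E.push (C := Z) (f + g) = E.push f + E.push g := by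
      simp only [push, Functor.map_add]; rfl
    rw [h, LinearMap.add_apply, hf, hg, add_zero]
  smul_mem' := fun c f hf Z δ => by
    have := E.linear_right (Opposite.op Z)
    have h : E.push (C := Z) (c • f) = c • E.push f := by
      simp only [push, Functor.map_smul]; rfl
    rw [h, LinearMap.smul_apply, hf, smul_zero]

/-- The morphisms `A ⟶ B` of the costable category: `𝒞(A, B) / ℐ(A, B)`. -/
abbrev CostableHom (A B : 𝒞) : Type _ := (A ⟶ B) ⧸ E.injTrivial A B

/-- The class in the costable category of a morphism. -/
abbrev costableMk {A B : 𝒞} (f : A ⟶ B) : E.CostableHom A B := (E.injTrivial A B).mkQ f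

variable (K : Type r) [AddCommGroup K] [Module k K]

/-- `T` is a choice of `τ_n C`: with `D = Hom_k(-, K)`, the object `T` represents the functor
`D 𝔼(C, -)` on the costable category, i.e. there is an isomorphism
`φ_Y : 𝒞̄(Y, T) ≃ D 𝔼(C, Y)` of `k`-modules, natural in `Y`. (The costable category has the same
objects as `𝒞` and its morphisms are classes of morphisms of `𝒞`, so naturality is tested on
morphisms of `𝒞`.) -/
def IsTau (C T : 𝒞) : Prop :=
  ∃ φ : ∀ Y : 𝒞, E.CostableHom Y T ≃ₗ[k] (E.Ext C Y →ₗ[k] K),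
    ∀ {Y Y' : 𝒞} (f : Y' ⟶ Y) (g : Y ⟶ T),
      φ Y' (E.costableMk (f ≫ g)) = (φ Y (E.costableMk g)).comp (E.push f)

/-- `C ∈ 𝒞_r`: the functor `D 𝔼(C, -)` on the costable category is representable. -/
def InCr (C : 𝒞) : Prop := ∃ T : 𝒞, E.IsTau K C T

end ExtBifunctor

end NExang

/-! By Yoneda, a representation of `D 𝔼(C, -)` by `T = τ_n C` amounts to a universal functional `e`
on `𝔼(C, T)`. It gives the pairing `(ε, h) ↦ e (h^* ε)` between `𝔼(X, T)` and `𝒞(C, X)`. This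
pairing has right kernel inside `𝒫` (`pull_eq_zero_of_pairing`) and zero left kernel
(`eq_zero_of_pairing`). The second fact rests on exactness of `𝒞(W, C) → 𝔼(W, A) → 𝔼(W, X_1)`, which
comes from good lifts.

Duality then makes `H` the common annihilator in `𝒞(C, X)` of those `ε` that `H` kills
(`exists_ext_of_notMem`). Finitely many such `ε` suffice, and they assemble into one `η ∈ 𝔼(X, T^m)`
with `h^* η = 0` iff `h ∈ H` (`exists_ext_annihilator`). In a realization of `η` with last map `α`,
a morphism `g` factors through `α` iff `g^* η = 0`. This gives `Im 𝒞(C, α) = H`, and left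
nondegeneracy gives determinacy. -/

namespace NExang

/-! ### Injectivity and cogeneration over `k`. -/

section Modules

/-- An injective module has the extension property for maps that need not be injective. -/
lemma exists_factor_of_ker_le {k : Type r} [CommRing k] {K : Type r} [AddCommGroup K] [Module k K]
    (hK : Module.Injective k K) {M : Type*} [AddCommGroup M] [Module k M] {N : Type*}
    [AddCommGroup N] [Module k N] (p : M →ₗ[k] N) (e : M →ₗ[k] K)
    (h : LinearMap.ker p ≤ LinearMap.ker e) : ∃ q : N →ₗ[k] K, q ∘ₗ p = e := by
  have hinj : Function.Injective ((LinearMap.ker p).liftQ p le_rfl) := by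
    rw [← LinearMap.ker_eq_bot]
    exact Submodule.ker_liftQ_eq_bot _ _ _ le_rfl
  obtain ⟨q, hq⟩ := (Module.Baer.of_injective hK).extension_property
    ((LinearMap.ker p).liftQ p le_rfl) hinj ((LinearMap.ker p).liftQ e h)
  refine ⟨q, LinearMap.ext fun x => ?_⟩
  simpa using LinearMap.congr_fun hq ((LinearMap.ker p).mkQ x)

/-- A cogenerator detects elements of finitely generated modules in every universe. -/
lemma IsCogenerator.exists_ne_zero {k : Type r} [CommRing k] {K : Type r} [AddCommGroup K]
    [Module k K] (hK : IsCogenerator k K) {M : Type*} [AddCommGroup M] [Module k M]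
    [Module.Finite k M] {x : M} (hx : x ≠ 0) : ∃ f : M →ₗ[k] K, f x ≠ 0 := by
  -- A quotient of `k^m` is a copy of `M` in the universe of `k`, where `hK` applies.
  obtain ⟨m, p, hp⟩ := Module.Finite.exists_fin' k M
  let φ := p.quotKerEquivOfSurjective hp
  obtain ⟨f, hf⟩ := hK _ inferInstance (φ.symm x) (by simpa using hx)
  exact ⟨f ∘ₗ φ.symm.toLinearMap, hf⟩

end Modules

variable {k : Type r} [CommRing k] {𝒞 : Type u} [Category.{v} 𝒞] [Preadditive 𝒞] [Linear k 𝒞]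

namespace ExtBifunctor

/-! ### Bilinearity and functoriality of `𝔼`. -/

section Functoriality

variable (E : ExtBifunctor.{w} k 𝒞)

lemma push_id {C A : 𝒞} (δ : E.Ext C A) : E.push (𝟙 A) δ = δ := by
  simp [push]

lemma push_comp {C A B D : 𝒞} (f : A ⟶ B) (g : B ⟶ D) (δ : E.Ext C A) :
    E.push (f ≫ g) δ = E.push g (E.push f δ) := by
  simp [push]

lemma push_sub {C A B : 𝒞} (f g : A ⟶ B) (δ : E.Ext C A) :
    E.push (f - g) δ = E.push f δ - E.push g δ := by
  have := E.additive_right (Opposite.op C)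
  have h : E.push (C := C) (f - g) = E.push f - E.push g := by
    simp only [push, Functor.map_sub]; rfl
  rw [h, LinearMap.sub_apply]

lemma push_zero {C A B : 𝒞} (δ : E.Ext C A) : E.push (0 : A ⟶ B) δ = 0 := by
  simpa using E.push_sub (0 : A ⟶ B) 0 δ

lemma push_add {C A B : 𝒞} (f g : A ⟶ B) (δ : E.Ext C A) :
    E.push (f + g) δ = E.push f δ + E.push g δ := by
  have := E.additive_right (Opposite.op C)
  have h : E.push (C := C) (f + g) = E.push f + E.push g := by
    simp only [push, Functor.map_add]; rfl
  rw [h, LinearMap.add_apply]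

lemma push_sum {C A B : 𝒞} {ι : Type*} (s : Finset ι) (f : ι → (A ⟶ B)) (δ : E.Ext C A) :
    E.push (∑ i ∈ s, f i) δ = ∑ i ∈ s, E.push (f i) δ := by
  classical
  induction s using Finset.induction_on with
  | empty => simpa using E.push_zero δ
  | insert i s hi ih => rw [Finset.sum_insert hi, Finset.sum_insert hi, push_add, ih]

lemma pull_id {C A : 𝒞} (δ : E.Ext C A) : E.pull (𝟙 C) δ = δ := by
  simp [pull]

lemma pull_comp {C C' C'' A : 𝒞} (f : C'' ⟶ C') (g : C' ⟶ C) (δ : E.Ext C A) :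
    E.pull (f ≫ g) δ = E.pull f (E.pull g δ) := by
  simp [pull]

lemma pull_add {C C' A : 𝒞} (f g : C' ⟶ C) (δ : E.Ext C A) :
    E.pull (f + g) δ = E.pull f δ + E.pull g δ := by
  have := E.additive_left A
  have h : E.pull (A := A) (f + g) = E.pull f + E.pull g := by
    change ((E.functor.flip.obj A).map (f + g).op).hom = _
    rw [op_add, Functor.map_add]; rfl
  rw [h, LinearMap.add_apply]

lemma pull_smul {C C' A : 𝒞} (t : k) (f : C' ⟶ C) (δ : E.Ext C A) :
    E.pull (t • f) δ = t • E.pull f δ := by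
  have h : E.pull (A := A) (t • f) = t • E.pull f := by
    simp only [pull, E.linear_left]; rfl
  rw [h, LinearMap.smul_apply]

lemma pull_zero {C C' A : 𝒞} (δ : E.Ext C A) : E.pull (0 : C' ⟶ C) δ = 0 := by
  simpa using E.pull_smul (0 : k) (0 : C' ⟶ C) δ

lemma pull_push {C C' A A' : 𝒞} (c : C' ⟶ C) (a : A ⟶ A') (δ : E.Ext C A) :
    E.pull c (E.push a δ) = E.push a (E.pull c δ) := by
  have h := congrArg ModuleCat.Hom.hom ((E.functor.map c.op).naturality a)
  exact LinearMap.congr_fun h δ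

/-- The pairing `𝔼(X, T) × 𝒞(C, X) → K` attached to a functional on `𝔼(C, T)`, as a linear map
in the second variable. -/
def pairing {K : Type r} [AddCommGroup K] [Module k K] {C T X : 𝒞} (e : E.Ext C T →ₗ[k] K)
    (ε : E.Ext X T) : (C ⟶ X) →ₗ[k] K where
  toFun h := e (E.pull h ε)
  map_add' f g := by rw [pull_add, map_add]
  map_smul' t f := by rw [pull_smul, map_smul, RingHom.id_apply]

end Functoriality

/-! ### Universal functionals and the right kernel of the pairing. -/

variable {E : ExtBifunctor.{w} k 𝒞} {K : Type r} [AddCommGroup K] [Module k K]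

/-- The functional `e` on `𝔼(C, T)` is a universal element of `D 𝔼(C, -)`: every functional on
`𝔼(C, Y)` has the form `e ∘ 𝔼(C, g)`, where `g : Y ⟶ T` is unique modulo `ℐ`. -/
structure IsUniversal {C T : 𝒞} (e : E.Ext C T →ₗ[k] K) : Prop where
  exists_push : ∀ {Y : 𝒞} (f : E.Ext C Y →ₗ[k] K), ∃ g : Y ⟶ T, ∀ δ, e (E.push g δ) = f δ
  sub_mem : ∀ {Y : 𝒞} (g g' : Y ⟶ T), (∀ δ : E.Ext C Y, e (E.push g δ) = e (E.push g' δ)) →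
    g - g' ∈ E.injTrivial Y T

/-- Yoneda: take `e` to be the image of the class of `𝟙 T`. Naturality turns the representing
isomorphism into `g ↦ e ∘ g_*`; its surjectivity and injectivity are the two fields. -/
lemma IsTau.exists_isUniversal {C T : 𝒞} (h : E.IsTau K C T) :
    ∃ e : E.Ext C T →ₗ[k] K, IsUniversal e := by
  obtain ⟨φ, hφ⟩ := h
  have key : ∀ {Y : 𝒞} (g : Y ⟶ T),
      φ Y (E.costableMk g) = (φ T (E.costableMk (𝟙 T))).comp (E.push g) := fun g => by
    rw [← hφ, Category.comp_id]
  refine ⟨φ T (E.costableMk (𝟙 T)), ⟨fun {Y} f => ?_, fun {Y} g g' hgg' => ?_⟩⟩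
  · obtain ⟨g, hg⟩ := (E.injTrivial Y T).mkQ_surjective ((φ Y).symm f)
    refine ⟨g, fun δ => ?_⟩
    have := key g
    rw [costableMk, hg, LinearEquiv.apply_symm_apply] at this
    exact (LinearMap.congr_fun this δ).symm
  · have : E.costableMk g = E.costableMk g' := (φ Y).injective (by
      rw [key g, key g']
      exact LinearMap.ext hgg')
    exact (Submodule.Quotient.eq _).1 this

/-- The pairing `𝔼(X, T) × 𝒞(C, X) → K` attached to a universal functional is nondegenerate in the
second variable modulo `𝒫`. -/
lemma IsUniversal.pull_eq_zero_of_pairing (hcog : IsCogenerator k K) (hfin : E.ExtFinite)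
    {C T : 𝒞} {e : E.Ext C T →ₗ[k] K} (he : IsUniversal e) {X : 𝒞} {h : C ⟶ X}
    (hh : ∀ ε : E.Ext X T, e (E.pull h ε) = 0) {Z : 𝒞} (δ : E.Ext X Z) : E.pull h δ = 0 := by
  by_contra hne
  have := hfin C Z
  obtain ⟨f, hf⟩ := hcog.exists_ne_zero hne
  -- With `f = e ∘ g_*`, one gets `f (h^* δ) = e (h^* (g_* δ)) = 0`.
  obtain ⟨g, hg⟩ := he.exists_push f
  apply hf
  rw [← hg, ← pull_push, hh]

end ExtBifunctor

/-! ### Exactness, duality and annihilators in `𝒞`. -/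

namespace NExangulated

variable [HasFiniteBiproducts 𝒞] {n : ℕ} (𝔛 : NExangulated.{w} k 𝒞 n)

lemma exists_distinguished {A C : 𝒞} (δ : 𝔛.E.Ext C A) :
    ∃ X : NComplex n A C, 𝔛.S.Distinguished X δ := by
  obtain ⟨X, hX⟩ := Quotient.exists_rep (𝔛.S.s δ)
  exact ⟨X, hX.symm⟩

/-- Exactness of `𝒞(W, C) → 𝔼(W, A) → 𝔼(W, X_1)` for a distinguished `n`-exangle. -/
lemma exists_pull_eq (hn : 1 ≤ n) {A C W : 𝒞} {ε : 𝔛.E.Ext C A} {X : NComplex n A C}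
    (hX : 𝔛.S.Distinguished X ε) {θ : 𝔛.E.Ext W A} (hθ : 𝔛.E.push X.dFirst θ = 0) :
    ∃ h : W ⟶ C, 𝔛.E.pull h ε = θ := by
  -- Glue `θ` and `ε` into one extension of `W ⊞ C`. The cone of a good lift of `(𝟙 A, biprod.inr)`
  -- realizes `(d_0)_* ρ`.
  let ρ : 𝔛.E.Ext (W ⊞ C) A := 𝔛.E.pull biprod.fst θ + 𝔛.E.pull biprod.snd ε
  have hl : 𝔛.E.pull biprod.inl ρ = θ := by
    simp only [ρ, map_add, ← ExtBifunctor.pull_comp, biprod.inl_fst, biprod.inl_snd,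
      ExtBifunctor.pull_id, ExtBifunctor.pull_zero, add_zero]
  have hr : 𝔛.E.pull biprod.inr ρ = ε := by
    simp only [ρ, map_add, ← ExtBifunctor.pull_comp, biprod.inr_fst, biprod.inr_snd,
      ExtBifunctor.pull_id, ExtBifunctor.pull_zero, zero_add]
  obtain ⟨Y, hY⟩ := 𝔛.exists_distinguished ρ
  obtain ⟨f, hf, M, ⟨φ, -, -, hlast⟩, hM⟩ := 𝔛.good_lift ρ biprod.inr X Y (by rwa [hr]) hY
  have hzero : 𝔛.E.push X.dFirst ρ = 0 := by
    simp only [ρ, map_add]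
    rw [← ExtBifunctor.pull_push, ← ExtBifunctor.pull_push, hθ,
      (𝔛.S.exangle ε X hX).push_eq_zero, map_zero, map_zero, add_zero]
  -- As the cone realizes zero, `biprod.inl` lifts along its last map. Pulling `ρ` back along the
  -- resulting decomposition of `biprod.inl` kills the part through `Y.dLast` and leaves `θ = h^*
  -- ε`.
  obtain ⟨s, hs⟩ := ((𝔛.S.exangle _ M hM).exact_contra_last W biprod.inl).1
    (by change 𝔛.E.pull _ _ = 0; rw [hzero, map_zero])
  let t := s ≫ (φ n hn le_rfl).hom
  have hs' : (t ≫ biprod.fst) ≫ X.right.hom ≫ biprod.inr + (t ≫ biprod.snd) ≫ Y.dLast =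
      biprod.inl := by
    rw [← hs, hlast hn, hf.right, biprod.desc_eq]
    simp [t]
  refine ⟨(t ≫ biprod.fst) ≫ X.right.hom, ?_⟩
  have := congrArg (fun g => 𝔛.E.pull g ρ) hs'
  simp only [hl] at this
  rw [ExtBifunctor.pull_add, 𝔛.E.pull_comp _ Y.dLast, (𝔛.S.exangle ρ Y hY).pull_eq_zero,
    map_zero, add_zero, ← Category.assoc, 𝔛.E.pull_comp _ biprod.inr, hr] at this
  exact this

variable {𝔛} {K : Type r} [AddCommGroup K] [Module k K]

/-- The pairing `𝔼(L, T) × 𝒞(C, L) → K` attached to a universal functional is nondegenerate in the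
first variable. -/
lemma eq_zero_of_pairing (hn : 1 ≤ n) (hK : Module.Injective k K) {C T : 𝒞}
    {e : 𝔛.E.Ext C T →ₗ[k] K} (he : ExtBifunctor.IsUniversal e) {L : 𝒞} {ε : 𝔛.E.Ext L T}
    (hε : ∀ h : C ⟶ L, e (𝔛.E.pull h ε) = 0) : ε = 0 := by
  obtain ⟨Y, hY⟩ := 𝔛.exists_distinguished ε
  -- The kernel of `(d_0)_*` on `𝔼(C, T)` consists of the `h^* ε`, where `e` vanishes; so `e = q ∘
  -- (d_0)_*`. Representing `q` by `g` makes `𝟙 T` agree with `d_0 ≫ g` modulo `ℐ`, and `(d_0)_* ε =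
  -- 0`.
  obtain ⟨q, hq⟩ := exists_factor_of_ker_le hK (𝔛.E.push (C := C) Y.dFirst) e (fun θ hθ => by
    obtain ⟨h, rfl⟩ := 𝔛.exists_pull_eq hn hY hθ
    exact hε h)
  obtain ⟨g, hg⟩ := he.exists_push q
  have hmem := he.sub_mem (𝟙 T) (Y.dFirst ≫ g) (fun δ => by
    rw [ExtBifunctor.push_id, ExtBifunctor.push_comp, hg, ← hq, LinearMap.comp_apply])
  have := hmem L ε
  rwa [ExtBifunctor.push_sub, ExtBifunctor.push_id, ExtBifunctor.push_comp,
    (𝔛.S.exangle ε Y hY).push_eq_zero, map_zero, sub_zero] at this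

/-- A morphism outside of a submodule `H ⊇ 𝒫` is detected by an extension annihilated by `H`. -/
lemma exists_ext_of_notMem [IsArtinianRing k] (hn : 1 ≤ n)
    (hK : IsMinimalInjectiveCogenerator k K) (hfin : 𝔛.E.ExtFinite) {C T X : 𝒞}
    {e : 𝔛.E.Ext C T →ₗ[k] K} (he : ExtBifunctor.IsUniversal e)
    (H : Submodule (End C)ᵐᵒᵖ (C ⟶ X)) (hH : (𝔛.E.projTrivial C X : Set (C ⟶ X)) ⊆ H)
    {h₀ : C ⟶ X} (h₀H : h₀ ∉ H) :
    ∃ ε : 𝔛.E.Ext X T, (∀ h ∈ H, 𝔛.E.pull h ε = 0) ∧ 𝔛.E.pull h₀ ε ≠ 0 := by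
  have hcomp : ∀ (u : C ⟶ C), ∀ h ∈ H, u ≫ h ∈ H := fun u h hh => H.smul_mem (MulOpposite.op u) hh
  -- Scalars act on `H` through the endomorphisms `t • 𝟙 C`.
  let Hk : Submodule k (C ⟶ X) :=
    { H.toAddSubmonoid with
      smul_mem' := fun t h hh => by
        have := hcomp (t • 𝟙 C) h hh
        rwa [Linear.smul_comp, Category.id_comp] at this }
  have := hfin X T
  obtain ⟨m, p, hp⟩ := Module.Finite.exists_fin' k (𝔛.E.Ext X T)
  let b : Fin m → 𝔛.E.Ext X T := fun i => p (Pi.single i 1)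
  -- Pairing with generators of `𝔼(X, T)` loses only the right kernel, which lies in `𝒫` and so in
  -- `H`.
  let Φ : (C ⟶ X) →ₗ[k] (Fin m → K) := LinearMap.pi fun i => 𝔛.E.pairing e (b i)
  have hker : LinearMap.ker Φ ≤ Hk := fun h hh => hH fun Z δ => by
    refine he.pull_eq_zero_of_pairing hK.cogenerator hfin (fun ε => ?_) δ
    obtain ⟨c, rfl⟩ := hp ε
    rw [pi_eq_sum_univ' c]
    simp only [map_sum, map_smul]
    refine Finset.sum_eq_zero fun i _ => ?_
    have : e (𝔛.E.pull h (b i)) = 0 := congrFun hh i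
    exact (congrArg (c i • ·) this).trans (smul_zero _)
  have hΦ : (Hk.map Φ).mkQ (Φ h₀) ≠ 0 := by
    intro h0
    obtain ⟨h, hh, hΦh⟩ := (Submodule.Quotient.mk_eq_zero _).1 h0
    have : h₀ - h ∈ Hk := hker (by rw [LinearMap.mem_ker, map_sub, hΦh, sub_self])
    exact h₀H ((Submodule.sub_mem_iff_left Hk hh).1 this)
  have := hK.finite
  obtain ⟨F', hF'⟩ := hK.cogenerator _ inferInstance _ hΦ
  let F : (Fin m → K) →ₗ[k] K := F' ∘ₗ (Hk.map Φ).mkQ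
  have hFH : ∀ h ∈ H, F (Φ h) = 0 := fun h hh => by
    have : (Hk.map Φ).mkQ (Φ h) = 0 :=
      (Submodule.Quotient.mk_eq_zero _).2 (Submodule.mem_map_of_mem hh)
    change F' ((Hk.map Φ).mkQ (Φ h)) = 0
    rw [this, map_zero]
  -- Each coordinate of `F`, composed with `e`, is induced by an endomorphism `g i` of `T`. This
  -- turns `F ∘ Φ` into the pairing with a single extension.
  choose g hg using fun i => he.exists_push (F ∘ₗ LinearMap.single k (fun _ => K) i ∘ₗ e)
  let ε := ∑ i, 𝔛.E.push (g i) (b i)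
  have hε : ∀ h : C ⟶ X, e (𝔛.E.pull h ε) = F (Φ h) := fun h => by
    have h1 : Φ h = ∑ i, Pi.single i (e (𝔛.E.pull h (b i))) :=
      (Finset.univ_sum_single (Φ h)).symm
    rw [h1]
    simp only [ε, map_sum]
    refine Finset.sum_congr rfl fun i _ => ?_
    rw [ExtBifunctor.pull_push, hg]
    rfl
  refine ⟨ε, fun h hh => eq_zero_of_pairing hn hK.injective he fun u => ?_, fun h0 => hF' ?_⟩
  -- Stability of `H` under `End C` kills all pairings of `h^* ε`, so left nondegeneracy applies
  -- with `L = C`.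
  · rw [← ExtBifunctor.pull_comp, hε, hFH _ (hcomp u h hh)]
  · have := hε h₀
    rw [h0, map_zero] at this
    exact this.symm

/-- A submodule `H ⊇ 𝒫` is the annihilator of an extension by a direct sum of copies of `T`. -/
lemma exists_ext_annihilator [IsArtinianRing k] (hn : 1 ≤ n)
    (hK : IsMinimalInjectiveCogenerator k K) (hfin : 𝔛.E.ExtFinite) {C T X : 𝒞}
    {e : 𝔛.E.Ext C T →ₗ[k] K} (he : ExtBifunctor.IsUniversal e)
    (H : Submodule (End C)ᵐᵒᵖ (C ⟶ X)) (hH : (𝔛.E.projTrivial C X : Set (C ⟶ X)) ⊆ H) :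
    ∃ (m : ℕ) (η : 𝔛.E.Ext X (⨁ fun _ : Fin m => T)),
      ∀ h : C ⟶ X, 𝔛.E.pull h η = 0 ↔ h ∈ H := by
  classical
  let N : Submodule k (𝔛.E.Ext X T) := ⨅ h : H, LinearMap.ker (𝔛.E.pull (A := T) h.1)
  have hN : ∀ ε, ε ∈ N ↔ ∀ h ∈ H, 𝔛.E.pull h ε = 0 := fun ε => by simp [N]
  have := hfin X T
  -- Artinian rings are noetherian, so `N` is finitely generated; its generators become the
  -- components of `η`.
  obtain ⟨m, b, hb⟩ := Submodule.fg_iff_exists_fin_generating_family.1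
    (IsNoetherian.noetherian N)
  refine ⟨m, ∑ i, 𝔛.E.push (biproduct.ι (fun _ : Fin m => T) i) (b i), fun h => ⟨fun h0 => ?_,
    fun hh => ?_⟩⟩
  · by_contra hH'
    obtain ⟨ε, hε, hne⟩ := exists_ext_of_notMem hn hK hfin he H hH hH'
    have hle : N ≤ LinearMap.ker (𝔛.E.pull (A := T) h) := by
      rw [← hb, Submodule.span_le]
      rintro _ ⟨j, rfl⟩
      have := congrArg (𝔛.E.push (biproduct.π (fun _ : Fin m => T) j)) h0
      simp only [map_sum, map_zero, ExtBifunctor.pull_push, ← ExtBifunctor.push_comp] at this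
      rw [Finset.sum_eq_single j (fun i _ hij => by
        rw [biproduct.ι_π_ne _ hij, ExtBifunctor.push_zero]) (by simp),
        biproduct.ι_π_self, ExtBifunctor.push_id] at this
      exact this
    exact hne (hle ((hN ε).2 hε))
  · simp only [map_sum, ExtBifunctor.pull_push]
    refine Finset.sum_eq_zero fun i _ => ?_
    rw [(hN (b i)).1 (hb ▸ Submodule.subset_span ⟨i, rfl⟩) h hh, map_zero]

/-- Extensions by a direct sum of copies of `T` are detected on morphisms from `C`. -/
lemma eq_zero_of_forall_pull (hn : 1 ≤ n) (hK : Module.Injective k K) {C T : 𝒞}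
    {e : 𝔛.E.Ext C T →ₗ[k] K} (he : ExtBifunctor.IsUniversal e) {L : 𝒞} {m : ℕ}
    {η : 𝔛.E.Ext L (⨁ fun _ : Fin m => T)} (hη : ∀ h : C ⟶ L, 𝔛.E.pull h η = 0) : η = 0 := by
  rw [← 𝔛.E.push_id η, ← biproduct.total, ExtBifunctor.push_sum]
  refine Finset.sum_eq_zero fun i _ => ?_
  have : 𝔛.E.push (biproduct.π (fun _ : Fin m => T) i) η = 0 :=
    eq_zero_of_pairing hn hK he fun h => by
      rw [ExtBifunctor.pull_push, hη, map_zero, map_zero]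
  rw [ExtBifunctor.push_comp, this, map_zero]

end NExangulated

lemma inAdd_biproduct [HasFiniteBiproducts 𝒞] (T : 𝒞) (m : ℕ) :
    InAdd T (⨁ fun _ : Fin m => T) :=
  -- The empty biproduct serves as a zero complement.
  ⟨m, ⨁ fun _ : Fin 0 => T, ⟨
    { hom := biprod.fst
      inv := biprod.inl
      hom_inv_id := by
        have h : (biprod.snd : (⨁ fun _ : Fin m => T) ⊞ (⨁ fun _ : Fin 0 => T) ⟶ _) = 0 :=
          biproduct.hom_ext _ _ fun i => i.elim0
        rw [← biprod.total, h, zero_comp, add_zero] }⟩⟩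

end NExang

theorem proposition4p7
    {k : Type r} [CommRing k] [IsArtinianRing k]
    {K : Type r} [AddCommGroup K] [Module k K]
    (hK : NExang.IsMinimalInjectiveCogenerator k K)
    {𝒞 : Type u} [Category.{v} 𝒞] [Preadditive 𝒞] [Linear k 𝒞] [HasFiniteBiproducts 𝒞]
    (hKS : NExang.IsKrullSchmidt 𝒞)
    (n : ℕ) (hn : 1 ≤ n)
    (𝔛 : NExang.NExangulated.{w} k 𝒞 n)
    (hfin : 𝔛.E.ExtFinite)
    (C : 𝒞) (hC : 𝔛.E.InCr K C)
    (τC : 𝒞) (hτ : 𝔛.E.IsTau K C τC)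
    (Xlast : 𝒞)
    (H : Submodule (End C)ᵐᵒᵖ (C ⟶ Xlast))
    (hH : (𝔛.E.projTrivial C Xlast : Set (C ⟶ Xlast)) ⊆ H) :
    ∃ (X₀ : 𝒞) (X : NExang.NComplex n X₀ Xlast) (η : 𝔛.E.Ext Xlast X₀),
      𝔛.S.Distinguished X η ∧
      NExang.IsRightDetermined C X.dLast ∧
      NExang.InAdd τC X₀ ∧
      (H : Set (C ⟶ Xlast)) = Set.range (fun s : C ⟶ X.cx.X n => s ≫ X.dLast) := by
  obtain ⟨e, he⟩ := hτ.exists_isUniversal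
  obtain ⟨m, η, hη⟩ := NExang.NExangulated.exists_ext_annihilator hn hK hfin he H hH
  obtain ⟨X, hX⟩ := 𝔛.exists_distinguished η
  have hex := (𝔛.S.exangle η X hX).exact_contra_last
  refine ⟨_, X, η, hX, fun L g hg => ?_, NExang.inAdd_biproduct τC m, ?_⟩
  · refine (hex L g).1 (NExang.NExangulated.eq_zero_of_forall_pull hn hK.injective he fun h => ?_)
    rw [← NExang.ExtBifunctor.pull_comp]
    exact (hex C (h ≫ g)).2 (hg h)
  · ext h
    exact (hη h).symm.trans (hex C h)
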